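/- Define the hypercube-like networks (HL-networks) recursively, up to isomorphism: the only $0$-dimensional HL-network is $K_1$, and the $n$-dimensional HL-networks ($n\ge 1$) are exactly the graphs obtained from the disjoint union of two $(n-1)$-dimensional HL-networks by adding the edges of an arbitrary perfect matching between their vertex sets. For a graph $G$ and a positive integer $k$, a $k$-component edge cut of $G$ is a set $F\subseteq E(G)$ such that $G-F$ has at least $k$ connected components, and $c\lambda_k(G)$ denotes the minimum size of a $k$-component edge cut of $G$. Let $n\ge 8$ and $0\le g\le 2^{\lceil n/2\rceil}$, let $G_n$ be an $n$-dimensional HL-network, and let $F$ be a $(g+1)$-component edge cut of $G_n$ with $|F|=c\lambda_{g+1}(G_n)$. Then $G_n-F$ contains exactly $g$ isolated vertices. -/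

import Mathlib

universe u v

/-- The perfect matching operation: the disjoint union of `G` and `H`, together with the edges
`{x, φ x}` of the perfect matching between their vertex sets given by the bijection `φ`. -/
def matchingSum {V : Type u} {W : Type v} (G : SimpleGraph V) (H : SimpleGraph W) (φ : V ≃ W) :
    SimpleGraph (V ⊕ W) where
  Adj x y :=
    match x, y with
    | Sum.inl a, Sum.inl b => G.Adj a b
    | Sum.inr a, Sum.inr b => H.Adj a b
    | Sum.inl a, Sum.inr b => φ a = b
    | Sum.inr a, Sum.inl b => φ b = a
  symm := ⟨by
    rintro (a | a) (b | b) h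
    · exact SimpleGraph.Adj.symm h
    · exact h
    · exact h
    · exact SimpleGraph.Adj.symm h⟩
  loopless := ⟨by
    rintro (a | a) h
    · exact G.loopless.irrefl a h
    · exact H.loopless.irrefl a h⟩

/-- `IsHLNetwork n G`: the graph `G` is an `n`-dimensional hypercube-like network (the families
are closed under isomorphism). The only `0`-dimensional one is `K₁`; the `(n+1)`-dimensional ones
are the graphs `G ⊕ H` obtained from two `n`-dimensional ones by adding an arbitrary perfect
matching between them. -/
inductive IsHLNetwork : ℕ → ∀ {V : Type u}, SimpleGraph V → Prop
  | zero {V : Type u} (G : SimpleGraph V) (hne : Nonempty V) (hss : Subsingleton V) :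
      IsHLNetwork 0 G
  | succ {n : ℕ} {V W U : Type u} (G : SimpleGraph V) (H : SimpleGraph W) (φ : V ≃ W)
      (K : SimpleGraph U) (e : K ≃g matchingSum G H φ)
      (hG : IsHLNetwork n G) (hH : IsHLNetwork n H) : IsHLNetwork (n + 1) K

/-- `F` is a `k`-component edge cut of `G`: a (finite) set of edges of `G` whose deletion leaves a
graph with at least `k` connected components. -/
def IsComponentEdgeCut {V : Type u} (G : SimpleGraph V) (k : ℕ) (F : Finset (Sym2 V)) : Prop :=
  (F : Set (Sym2 V)) ⊆ G.edgeSet ∧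
    (k : ℕ∞) ≤ ENat.card (G.deleteEdges (F : Set (Sym2 V))).ConnectedComponent

/-- The `k`-component edge connectivity of `G`: the minimum size of a `k`-component edge cut. -/
noncomputable def componentEdgeConnectivity {V : Type u} (G : SimpleGraph V) (k : ℕ) : ℕ :=
  sInf {c : ℕ | ∃ F : Finset (Sym2 V), IsComponentEdgeCut G k F ∧ F.card = c}

/-!
Let `f m = bitSum m` be the number of binary digits `1` among the numbers below `m`. In an
`n`-dimensional hypercube-like network every set of `m` vertices spans at most `f m` edges
(`IsHLNetwork.spannedPairs_le`, by induction on the dimension from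
`f a + f b + min a b ≤ f (a + b)`), and for each `m ≤ 2 ^ n` some set attains this
(`IsHLNetwork.exists_spannedPairs_eq`).

Isolating all vertices outside an optimal set of `2 ^ n - g` vertices is a `(g + 1)`-component edge
cut, so a minimum cut leaves at least `f (2 ^ n - g)` edges. If the components left by the cut have
`x c + 1` vertices, then at most `∑ c, f (x c + 1)` edges are left. The function `x ↦ f (x + 1)` is
strictly increasing and superadditive, so this is at most `f (∑ c, x c + 1)`, where `∑ c, x c` is
`2 ^ n` minus the number of components; hence there are exactly `g + 1` components and equality
holds throughout. Superadditivity is strict for two positive arguments unless their sum is a power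
of two (`bitSum_succ_add_bitSum_succ_lt`), and the bound on `g` places `2 ^ n - g - 1` strictly
between `2 ^ (n - 1)` and `2 ^ n`. Therefore only one component has more than one vertex, and the
other `g` are isolated vertices.
-/

/-! ### Binary digit sums -/

/-- The total number of binary digits `1` among the numbers below `m`: the greatest number of
edges spanned by `m` vertices of a hypercube-like network. -/
def bitSum (m : ℕ) : ℕ := ∑ k ∈ Finset.range m, (Nat.digits 2 k).sum

theorem bitSum_zero : bitSum 0 = 0 := rfl

theorem bitSum_one : bitSum 1 = 0 := by simp [bitSum]

theorem bitSum_two_mul_and (m : ℕ) :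
    bitSum (2 * m) = 2 * bitSum m + m ∧ bitSum (2 * m + 1) = bitSum m + bitSum (m + 1) + m := by
  have hd : ∀ k, (Nat.digits 2 (2 * k)).sum = (Nat.digits 2 k).sum := by
    intro k
    rcases Nat.eq_zero_or_pos k with rfl | hk
    · rfl
    · rw [Nat.digits_def' (by norm_num) (by omega)]
      simp
  have hd' : ∀ k, (Nat.digits 2 (2 * k + 1)).sum = (Nat.digits 2 k).sum + 1 := by
    intro k
    rw [Nat.digits_def' (by norm_num) (by omega)]
    have h1 : (2 * k + 1) % 2 = 1 := by omega
    have h2 : (2 * k + 1) / 2 = k := by omega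
    rw [h1, h2, List.sum_cons, add_comm]
  have hs : ∀ k, bitSum (k + 1) = bitSum k + (Nat.digits 2 k).sum := fun k =>
    Finset.sum_range_succ _ _
  have he : bitSum (2 * m) = 2 * bitSum m + m := by
    induction m with
    | zero => rfl
    | succ k ih =>
      rw [show 2 * (k + 1) = 2 * k + 1 + 1 by ring, hs, hs, hd, hd', ih, hs]
      ring
  exact ⟨he, by rw [hs, he, hd, hs]; ring⟩

theorem bitSum_two_mul (m : ℕ) : bitSum (2 * m) = 2 * bitSum m + m :=
  (bitSum_two_mul_and m).1

theorem bitSum_two_mul_add_one (m : ℕ) :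
    bitSum (2 * m + 1) = bitSum m + bitSum (m + 1) + m :=
  (bitSum_two_mul_and m).2

theorem bitSum_lt_succ {m : ℕ} (hm : 0 < m) : bitSum m < bitSum (m + 1) := by
  induction m using Nat.strong_induction_on with
  | _ m ih =>
    obtain ⟨k, rfl | rfl⟩ := Nat.even_or_odd' m
    · have := ih k (by omega) (by omega)
      rw [bitSum_two_mul, bitSum_two_mul_add_one]
      omega
    · rw [show 2 * k + 1 + 1 = 2 * (k + 1) by ring, bitSum_two_mul, bitSum_two_mul_add_one]
      rcases Nat.eq_zero_or_pos k with rfl | hk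
      · simp [bitSum_zero, bitSum_one]
      · have := ih k (by omega) hk
        omega

theorem bitSum_add_two_le_succ {m : ℕ} (hm : 0 < m) (hpow : ∀ j, m ≠ 2 ^ j) :
    bitSum m + 2 ≤ bitSum (m + 1) := by
  induction m using Nat.strong_induction_on with
  | _ m ih =>
    obtain ⟨k, rfl | rfl⟩ := Nat.even_or_odd' m
    · have := ih k (by omega) (by omega) fun j hj => hpow (j + 1) (by rw [hj, pow_succ, mul_comm])
      rw [bitSum_two_mul, bitSum_two_mul_add_one]
      omega
    · rw [show 2 * k + 1 + 1 = 2 * (k + 1) by ring, bitSum_two_mul, bitSum_two_mul_add_one]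
      have hk : 0 < k := by
        by_contra h
        exact hpow 0 (by simp; omega)
      have := bitSum_lt_succ hk
      omega

theorem bitSum_succ_strictMono : StrictMono fun x => bitSum (x + 1) :=
  strictMono_nat_of_lt_succ fun x => bitSum_lt_succ x.succ_pos

/-- The numerical form of the induction step bounding the number of edges spanned by a vertex
set: two halves with `a` and `b` chosen vertices are joined by at most `min a b` edges. -/
theorem bitSum_add_add_min_le (a b : ℕ) : bitSum a + bitSum b + min a b ≤ bitSum (a + b) := by
  induction hs : a + b using Nat.strong_induction_on generalizing a b with
  | _ s ih =>
    subst hs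
    have key : ∀ x y, x + y < a + b → bitSum x + bitSum y + min x y ≤ bitSum (x + y) :=
      fun x y h => ih _ h x y rfl
    rcases Nat.eq_zero_or_pos a with rfl | ha
    · simp [bitSum_zero]
    rcases Nat.eq_zero_or_pos b with rfl | hb
    · simp [bitSum_zero]
    obtain ⟨x, rfl | rfl⟩ := Nat.even_or_odd' a <;> obtain ⟨y, rfl | rfl⟩ := Nat.even_or_odd' b
    · have h1 := key x y (by omega)
      rw [show 2 * x + 2 * y = 2 * (x + y) by ring]
      simp only [bitSum_two_mul]
      omega
    · have h1 := key x y (by omega)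
      have h2 := key x (y + 1) (by omega)
      rw [show 2 * x + (2 * y + 1) = 2 * (x + y) + 1 by ring]
      simp only [bitSum_two_mul, bitSum_two_mul_add_one]
      rw [← add_assoc] at h2
      omega
    · have h1 := key x y (by omega)
      have h2 := key (x + 1) y (by omega)
      rw [show 2 * x + 1 + 2 * y = 2 * (x + y) + 1 by ring]
      simp only [bitSum_two_mul, bitSum_two_mul_add_one]
      rw [add_right_comm x 1 y] at h2
      omega
    · have h1 := key x (y + 1) (by omega)
      have h2 := key (x + 1) y (by omega)
      rw [show 2 * x + 1 + (2 * y + 1) = 2 * (x + y + 1) by ring]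
      simp only [bitSum_two_mul, bitSum_two_mul_add_one]
      rw [← add_assoc] at h1
      rw [add_right_comm x 1 y] at h2
      omega

theorem bitSum_two_pow_add (t r : ℕ) (hr : r ≤ 2 ^ t) :
    bitSum (2 ^ t + r) = bitSum (2 ^ t) + bitSum r + r := by
  induction t generalizing r with
  | zero =>
    have : r = 0 ∨ r = 1 := by simp at hr; omega
    rcases this with rfl | rfl
    · simp [bitSum_zero]
    · simpa [bitSum_one] using bitSum_two_mul 1
  | succ t ih =>
    rw [pow_succ, mul_comm] at hr ⊢
    obtain ⟨s, rfl | rfl⟩ := Nat.even_or_odd' r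
    · rw [show 2 * 2 ^ t + 2 * s = 2 * (2 ^ t + s) by ring]
      simp only [bitSum_two_mul, ih s (by omega)]
      ring
    · have h := ih (s + 1) (by omega)
      rw [← add_assoc] at h
      rw [show 2 * 2 ^ t + (2 * s + 1) = 2 * (2 ^ t + s) + 1 by ring]
      simp only [bitSum_two_mul, bitSum_two_mul_add_one, ih s (by omega), h]
      ring

theorem bitSum_succ_superadditive_and_strict (a b : ℕ) :
    bitSum (a + 1) + bitSum (b + 1) ≤ bitSum (a + b + 1) ∧
      (0 < a → 0 < b → (∀ j, a + b ≠ 2 ^ j) →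
        bitSum (a + 1) + bitSum (b + 1) < bitSum (a + b + 1)) := by
  induction hs : a + b using Nat.strong_induction_on generalizing a b with
  | _ s ih =>
    subst hs
    have key : ∀ x y, x + y < a + b → bitSum (x + 1) + bitSum (y + 1) ≤ bitSum (x + y + 1) :=
      fun x y h => (ih _ h x y rfl).1
    have mono : ∀ x, bitSum (x + 1) < bitSum (x + 1 + 1) := fun x => bitSum_lt_succ x.succ_pos
    rcases Nat.eq_zero_or_pos a with rfl | ha
    · simp [bitSum_one]
    rcases Nat.eq_zero_or_pos b with rfl | hb
    · simp [bitSum_one]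
    obtain ⟨x, rfl | rfl⟩ := Nat.even_or_odd' a <;> obtain ⟨y, rfl | rfl⟩ := Nat.even_or_odd' b
    · obtain ⟨x, rfl⟩ := Nat.exists_eq_succ_of_ne_zero (show x ≠ 0 by omega)
      obtain ⟨y, rfl⟩ := Nat.exists_eq_succ_of_ne_zero (show y ≠ 0 by omega)
      have h1 := key (x + 1) y (by omega)
      have h2 := key x (y + 1) (by omega)
      have h3 := mono (x + y + 1)
      rw [show 2 * x.succ + 2 * y.succ + 1 = 2 * (x + y + 1 + 1) + 1 by
        simp only [Nat.succ_eq_add_one]; ring]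
      simp only [Nat.succ_eq_add_one, bitSum_two_mul_add_one]
      rw [show x + 1 + y + 1 = x + y + 1 + 1 by ring] at h1
      rw [show x + (y + 1) + 1 = x + y + 1 + 1 by ring] at h2
      omega
    · obtain ⟨x, rfl⟩ := Nat.exists_eq_succ_of_ne_zero (show x ≠ 0 by omega)
      have h1 := key (x + 1) y (by omega)
      have h2 := key x y (by omega)
      have h3 := mono (x + y)
      rw [show 2 * x.succ + (2 * y + 1) + 1 = 2 * (x + y + 1 + 1) by
        simp only [Nat.succ_eq_add_one]; ring, show 2 * y + 1 + 1 = 2 * (y + 1) by ring]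
      simp only [Nat.succ_eq_add_one, bitSum_two_mul_add_one, bitSum_two_mul]
      rw [show x + 1 + y + 1 = x + y + 1 + 1 by ring] at h1
      omega
    · obtain ⟨y, rfl⟩ := Nat.exists_eq_succ_of_ne_zero (show y ≠ 0 by omega)
      have h1 := key x (y + 1) (by omega)
      have h2 := key x y (by omega)
      have h3 := mono (x + y)
      rw [show 2 * x + 1 + 2 * y.succ + 1 = 2 * (x + y + 1 + 1) by
        simp only [Nat.succ_eq_add_one]; ring, show 2 * x + 1 + 1 = 2 * (x + 1) by ring]
      simp only [Nat.succ_eq_add_one, bitSum_two_mul_add_one, bitSum_two_mul]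
      rw [← add_assoc] at h1
      omega
    · have h1 := key x y (by omega)
      have h3 := mono (x + y)
      rw [show 2 * x + 1 + (2 * y + 1) + 1 = 2 * (x + y + 1) + 1 by ring,
        show 2 * x + 1 + 1 = 2 * (x + 1) by ring, show 2 * y + 1 + 1 = 2 * (y + 1) by ring]
      simp only [bitSum_two_mul_add_one, bitSum_two_mul]
      refine ⟨by omega, fun _ _ hpow => ?_⟩
      have h4 : bitSum (x + y + 1) + 2 ≤ bitSum (x + y + 1 + 1) :=
        bitSum_add_two_le_succ (Nat.succ_pos _) fun j hj => hpow (j + 1) (by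
          rw [pow_succ, ← hj]; ring)
      omega

/-- Shifting the argument by one makes `bitSum` superadditive: one component of `a + b + 1`
vertices together with a singleton can hold at least as many edges as components of `a + 1` and
`b + 1` vertices. -/
theorem bitSum_succ_add_bitSum_succ_le (a b : ℕ) :
    bitSum (a + 1) + bitSum (b + 1) ≤ bitSum (a + b + 1) :=
  (bitSum_succ_superadditive_and_strict a b).1

/-- The case `a = 1`, `b + 1 = 2 ^ j` gives equality, so that powers of two have to be excluded. -/
theorem bitSum_succ_add_bitSum_succ_lt {a b : ℕ} (ha : 0 < a) (hb : 0 < b)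
    (hpow : ∀ j, a + b ≠ 2 ^ j) :
    bitSum (a + 1) + bitSum (b + 1) < bitSum (a + b + 1) :=
  (bitSum_succ_superadditive_and_strict a b).2 ha hb hpow

theorem sum_bitSum_succ_le {ι : Type*} (s : Finset ι) (x : ι → ℕ) :
    ∑ i ∈ s, bitSum (x i + 1) ≤ bitSum (∑ i ∈ s, x i + 1) := by
  classical
  induction s using Finset.induction_on with
  | empty => simp [bitSum_one]
  | insert i s hi ih =>
    rw [Finset.sum_insert hi, Finset.sum_insert hi]
    exact (Nat.add_le_add_left ih _).trans (bitSum_succ_add_bitSum_succ_le _ _)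

theorem sum_bitSum_succ_lt {ι : Type*} {s : Finset ι} {x : ι → ℕ} {i j : ι} (hi : i ∈ s)
    (hj : j ∈ s) (hij : i ≠ j) (hxi : 0 < x i) (hxj : 0 < x j)
    (hpow : ∀ k, ∑ i ∈ s, x i ≠ 2 ^ k) :
    ∑ i ∈ s, bitSum (x i + 1) < bitSum (∑ i ∈ s, x i + 1) := by
  classical
  have hrest : 0 < ∑ l ∈ s.erase i, x l :=
    hxj.trans_le (Finset.single_le_sum (f := x) (fun _ _ => Nat.zero_le _)
      (Finset.mem_erase.2 ⟨hij.symm, hj⟩))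
  rw [← Finset.add_sum_erase s _ hi] at hpow ⊢
  rw [← Finset.add_sum_erase s x hi]
  exact (Nat.add_le_add_left (sum_bitSum_succ_le _ _) _).trans_lt
    (bitSum_succ_add_bitSum_succ_lt hxi hrest hpow)

/-! ### Edges spanned by a vertex set -/

open Classical in
/-- The number of ordered pairs of adjacent vertices in `S`, that is, twice the number of edges
of `G` spanned by `S`. -/
noncomputable def spannedPairs {V : Type*} (G : SimpleGraph V) (S : Finset V) : ℕ :=
  ∑ x ∈ S, ∑ y ∈ S, if G.Adj x y then 1 else 0

theorem spannedPairs_mono_left {V : Type*} {G H : SimpleGraph V} (h : G ≤ H) (S : Finset V) :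
    spannedPairs G S ≤ spannedPairs H S := by
  unfold spannedPairs
  gcongr with x _ y _
  split_ifs with h1 h2
  · rfl
  · exact absurd (h h1) h2
  · exact Nat.zero_le _
  · rfl

theorem spannedPairs_map {V W : Type*} {G : SimpleGraph V} {H : SimpleGraph W} (e : G ≃g H)
    (S : Finset V) : spannedPairs H (S.map e.toEquiv.toEmbedding) = spannedPairs G S := by
  simp only [spannedPairs, Finset.sum_map]
  refine Finset.sum_congr rfl fun x _ => Finset.sum_congr rfl fun y _ => ?_
  have h : H.Adj (e.toEquiv.toEmbedding x) (e.toEquiv.toEmbedding y) ↔ G.Adj x y := e.map_adj_iff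
  split_ifs <;> tauto

open Classical in
theorem spannedPairs_matchingSum {V W : Type*} (G : SimpleGraph V) (H : SimpleGraph W)
    (φ : V ≃ W) (A : Finset V) (B : Finset W) :
    spannedPairs (matchingSum G H φ) (A.disjSum B) =
      spannedPairs G A + spannedPairs H B + 2 * (A.filter fun a => φ a ∈ B).card := by
  have h1 : ∀ x y, (matchingSum G H φ).Adj (.inl x) (.inl y) ↔ G.Adj x y := fun _ _ => Iff.rfl
  have h2 : ∀ x y, (matchingSum G H φ).Adj (.inr x) (.inr y) ↔ H.Adj x y := fun _ _ => Iff.rfl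
  have h3 : ∀ x y, (matchingSum G H φ).Adj (.inl x) (.inr y) ↔ φ x = y := fun _ _ => Iff.rfl
  have h4 : ∀ x y, (matchingSum G H φ).Adj (.inr x) (.inl y) ↔ φ y = x := fun _ _ => Iff.rfl
  have hc : ∑ x ∈ B, ∑ y ∈ A, (if φ y = x then 1 else 0) =
      (A.filter fun a => φ a ∈ B).card := by
    rw [Finset.sum_comm, Finset.card_filter]
    simp
  simp only [spannedPairs, Finset.sum_disjSum, h1, h2, h3, h4, Finset.sum_add_distrib, hc]
  simp only [Finset.sum_ite_eq, ← Finset.card_filter]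
  ring

theorem spannedPairs_univ {V : Type*} [Fintype V] (G : SimpleGraph V) :
    spannedPairs G Finset.univ = 2 * G.edgeSet.ncard := by
  classical
  rw [← SimpleGraph.coe_edgeFinset, Set.ncard_coe_finset,
    ← SimpleGraph.sum_degrees_eq_twice_card_edges]
  refine Finset.sum_congr rfl fun x _ => ?_
  rw [← Finset.card_filter, ← SimpleGraph.card_neighborFinset_eq_degree,
    SimpleGraph.neighborFinset_eq_filter]

theorem IsHLNetwork.finite_and_natCard {n : ℕ} {V : Type*} {G : SimpleGraph V}
    (hG : IsHLNetwork n G) : Finite V ∧ Nat.card V = 2 ^ n := by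
  induction hG with
  | zero G hne hss => exact ⟨inferInstance, by simp⟩
  | succ G H φ K e hG hH ihG ihH =>
    have := ihG.1
    have := ihH.1
    refine ⟨Finite.of_equiv _ e.symm.toEquiv, ?_⟩
    rw [Nat.card_congr e.toEquiv, Nat.card_sum, ihG.2, ihH.2]
    ring

theorem IsHLNetwork.spannedPairs_le {n : ℕ} {V : Type*} {G : SimpleGraph V}
    (hG : IsHLNetwork n G) (S : Finset V) : spannedPairs G S ≤ 2 * bitSum S.card := by
  classical
  induction hG with
  | zero G hne hss =>
    have : ∀ x y, ¬ G.Adj x y := fun x y h => h.ne (Subsingleton.elim x y)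
    simp [spannedPairs, this]
  | @succ n V W U G H φ K e hG hH ihG ihH =>
    set T := S.map e.toEquiv.toEmbedding with hT
    rw [← spannedPairs_map e, ← Finset.card_map e.toEquiv.toEmbedding, ← hT,
      ← T.toLeft_disjSum_toRight, spannedPairs_matchingSum, Finset.card_disjSum]
    have hA : (T.toLeft.filter fun a => φ a ∈ T.toRight).card ≤ T.toLeft.card :=
      Finset.card_filter_le _ _
    have hB : (T.toLeft.filter fun a => φ a ∈ T.toRight).card ≤ T.toRight.card :=
      Finset.card_le_card_of_injOn φ (fun a ha => (Finset.mem_filter.1 ha).2) φ.injective.injOn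
    have := ihG T.toLeft
    have := ihH T.toRight
    have := bitSum_add_add_min_le T.toLeft.card T.toRight.card
    omega

/-- The bound of `IsHLNetwork.spannedPairs_le` is attained in every size: take a whole half of
the network and an optimal set in the other half, or an optimal set in one half. -/
theorem IsHLNetwork.exists_spannedPairs_eq {n : ℕ} {V : Type*} {G : SimpleGraph V}
    (hG : IsHLNetwork n G) {m : ℕ} (hm : m ≤ 2 ^ n) :
    ∃ S : Finset V, S.card = m ∧ spannedPairs G S = 2 * bitSum m := by
  classical
  induction hG generalizing m with
  | @zero V G hne hss =>
    have hadj : ∀ x y, ¬ G.Adj x y := fun x y h => h.ne (Subsingleton.elim x y)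
    obtain ⟨v⟩ := hne
    have : m = 0 ∨ m = 1 := by simp at hm; omega
    rcases this with rfl | rfl
    · exact ⟨∅, rfl, by simp [spannedPairs, bitSum_zero]⟩
    · exact ⟨{v}, rfl, by simp [spannedPairs, hadj, bitSum_one]⟩
  | @succ n V W U G H φ K e hG hH ihG ihH =>
    suffices h : ∃ S : Finset (V ⊕ W), S.card = m ∧
        spannedPairs (matchingSum G H φ) S = 2 * bitSum m by
      obtain ⟨S, hS, hS'⟩ := h
      exact ⟨S.map e.symm.toEquiv.toEmbedding, by simpa using hS,
        (spannedPairs_map e.symm S).trans hS'⟩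
    rcases le_total m (2 ^ n) with hmn | hmn
    · obtain ⟨A, hA, hA'⟩ := ihG hmn
      exact ⟨A.disjSum ∅, by simpa using hA, by
        rw [spannedPairs_matchingSum, hA']; simp [spannedPairs]⟩
    · obtain ⟨r, rfl⟩ := Nat.exists_eq_add_of_le hmn
      have hr : r ≤ 2 ^ n := by rw [pow_succ] at hm; omega
      have := hG.finite_and_natCard.1
      have := Fintype.ofFinite V
      obtain ⟨A, hA, hA'⟩ := ihG le_rfl
      obtain ⟨B, hB, hB'⟩ := ihH hr
      have hAu : A = Finset.univ := by
        rw [← Finset.card_eq_iff_eq_univ, hA, ← Nat.card_eq_fintype_card, hG.finite_and_natCard.2]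
      have hc : (A.filter fun a => φ a ∈ B).card = r := by
        rw [← hB, ← Finset.card_map φ.symm.toEmbedding (s := B)]
        congr 1
        ext a
        simp [hAu]
      exact ⟨A.disjSum B, by rw [Finset.card_disjSum, hA, hB], by
        rw [spannedPairs_matchingSum, hA', hB', hc, bitSum_two_pow_add n r hr]; ring⟩

/-! ### Component edge cuts -/

theorem spannedPairs_deleteEdges_add {V : Type*} [Fintype V] {G : SimpleGraph V}
    {F : Finset (Sym2 V)} (hF : (F : Set (Sym2 V)) ⊆ G.edgeSet) :
    spannedPairs (G.deleteEdges (F : Set (Sym2 V))) Finset.univ + 2 * F.card =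
      spannedPairs G Finset.univ := by
  rw [spannedPairs_univ, spannedPairs_univ, SimpleGraph.edgeSet_deleteEdges,
    ← Set.ncard_coe_finset F, ← Set.ncard_sdiff_add_ncard_of_subset hF (Set.toFinite _)]
  ring

open Classical in
theorem spannedPairs_univ_eq_sum_components {V : Type*} [Fintype V] (H : SimpleGraph V)
    [Fintype H.ConnectedComponent] :
    spannedPairs H Finset.univ = ∑ c : H.ConnectedComponent,
      spannedPairs H (Finset.univ.filter fun v => H.connectedComponentMk v = c) := by
  have h : ∀ x, ∑ y, (if H.Adj x y then 1 else 0) =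
      ∑ y ∈ Finset.univ.filter (fun v => H.connectedComponentMk v = H.connectedComponentMk x),
        if H.Adj x y then 1 else 0 := by
    intro x
    refine (Finset.sum_subset (Finset.filter_subset _ _) fun y _ hy => if_neg fun hxy => hy ?_).symm
    simpa using hxy.reachable.symm
  unfold spannedPairs
  rw [← Finset.sum_fiberwise Finset.univ H.connectedComponentMk]
  refine Finset.sum_congr rfl fun c _ => Finset.sum_congr rfl fun x hx => ?_
  rw [h x, (Finset.mem_filter.1 hx).2]

/-- Deleting all edges not spanned by a nonempty set `S` isolates the vertices outside `S`. -/
theorem exists_isComponentEdgeCut_of_finset {V : Type*} [Fintype V] (G : SimpleGraph V)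
    {S : Finset V} (hS : S.Nonempty) {k : ℕ} (hk : S.card + k = Fintype.card V + 1) :
    ∃ F : Finset (Sym2 V), IsComponentEdgeCut G k F ∧
      spannedPairs G S ≤ spannedPairs (G.deleteEdges (F : Set (Sym2 V))) Finset.univ := by
  classical
  obtain ⟨s, hs⟩ := hS
  set F : Finset (Sym2 V) := G.edgeFinset.filter fun e => ¬ ∀ v ∈ e, v ∈ S with hFdef
  have hadj : ∀ x y, (G.deleteEdges (F : Set (Sym2 V))).Adj x y ↔ G.Adj x y ∧ x ∈ S ∧ y ∈ S := by
    intro x y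
    rw [SimpleGraph.deleteEdges_adj, hFdef]
    simp only [Finset.coe_filter, Set.mem_ofPred_eq, SimpleGraph.mem_edgeFinset,
      SimpleGraph.mem_edgeSet, Sym2.mem_iff, forall_eq_or_imp, forall_eq]
    tauto
  refine ⟨F, ⟨fun e he => ?_, ?_⟩, ?_⟩
  · simpa using (Finset.mem_filter.1 he).1
  · set H := G.deleteEdges (F : Set (Sym2 V))
    have hreach : ∀ x y, x ∉ S → H.Reachable x y → x = y := by
      rintro x y hx ⟨w⟩
      cases w with
      | nil => rfl
      | cons h _ => exact absurd ((hadj _ _).1 h).2.1 hx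
    have hinj : Set.InjOn H.connectedComponentMk (insert s Sᶜ : Finset V) := by
      intro x hx y hy hxy
      have hxy : H.Reachable x y := SimpleGraph.ConnectedComponent.exact hxy
      rcases Finset.mem_insert.1 hx with rfl | hx
      · rcases Finset.mem_insert.1 hy with rfl | hy
        · rfl
        · exact (hreach y x (Finset.mem_compl.1 hy) hxy.symm).symm
      · exact hreach x y (Finset.mem_compl.1 hx) hxy
    have hcard : (insert s Sᶜ : Finset V).card = k := by
      rw [Finset.card_insert_of_notMem (by simpa using hs), Finset.card_compl]
      have := S.card_le_univ
      omega
    have : Fintype H.ConnectedComponent := Fintype.ofFinite _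
    rw [ENat.card_eq_coe_fintype_card, Nat.cast_le, ← hcard]
    exact Finset.card_le_card_of_injOn _ (fun _ _ => Finset.mem_univ _) hinj
  · calc spannedPairs G S = spannedPairs (G.deleteEdges (F : Set (Sym2 V))) S := by
          refine Finset.sum_congr rfl fun x hx => Finset.sum_congr rfl fun y hy => ?_
          simp only [hadj, hx, hy, and_true]
      _ ≤ _ := by
          unfold spannedPairs
          exact (Finset.sum_le_sum fun x _ => Finset.sum_le_univ_sum_of_nonneg
            fun _ => Nat.zero_le _).trans
            (Finset.sum_le_univ_sum_of_nonneg fun _ => Nat.zero_le _)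

/-- The choice of a cut isolating the complement of an optimal set of `2 ^ n - g` vertices bounds
the connectivity from above, so a minimum cut leaves at least as many edges as that one. -/
theorem IsHLNetwork.bitSum_le_spannedPairs_deleteEdges {V : Type*} [Fintype V] {n g : ℕ}
    {G : SimpleGraph V} (hG : IsHLNetwork n G) (hg : g < 2 ^ n) {F : Finset (Sym2 V)}
    (hF : IsComponentEdgeCut G (g + 1) F) (hmin : F.card = componentEdgeConnectivity G (g + 1)) :
    2 * bitSum (2 ^ n - g) ≤ spannedPairs (G.deleteEdges (F : Set (Sym2 V))) Finset.univ := by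
  have hcard : Fintype.card V = 2 ^ n := by
    rw [← Nat.card_eq_fintype_card, hG.finite_and_natCard.2]
  obtain ⟨S, hS, hS'⟩ := hG.exists_spannedPairs_eq (Nat.sub_le (2 ^ n) g)
  obtain ⟨F', hF', hle⟩ := exists_isComponentEdgeCut_of_finset G
    (Finset.card_pos.1 (by omega)) (show S.card + (g + 1) = Fintype.card V + 1 by omega)
  have h1 := spannedPairs_deleteEdges_add hF.1
  have h2 := spannedPairs_deleteEdges_add hF'.1
  have h3 : F.card ≤ F'.card := hmin ▸ Nat.sInf_le ⟨F', hF', rfl⟩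
  omega

theorem isIsolated_iff_of_forall_component {V : Type*} [Fintype V] {H : SimpleGraph V}
    {c : H.ConnectedComponent} (hc : 1 < c.supp.ncard)
    (hne : ∀ d : H.ConnectedComponent, d ≠ c → d.supp.ncard ≤ 1) (v : V) :
    H.IsIsolated v ↔ v ∉ c.supp := by
  constructor
  · intro hv hvc
    obtain ⟨w, hw, hwv⟩ := Set.exists_ne_of_one_lt_ncard hc v
    obtain ⟨p⟩ : H.Reachable v w :=
      SimpleGraph.ConnectedComponent.exact (hvc.trans hw.symm)
    cases p with
    | nil => exact hwv rfl
    | cons h _ => exact hv _ h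
  · intro hv w hvw
    refine hvw.ne ((Set.ncard_le_one (Set.toFinite _)).1 (hne (H.connectedComponentMk v) hv) v rfl
      w ?_)
    exact SimpleGraph.ConnectedComponent.sound hvw.reachable.symm

theorem mainTheorem3 {V : Type*} (n g : ℕ) (hn : 8 ≤ n) (hg : g ≤ 2 ^ ⌈(n : ℚ) / 2⌉₊)
    (G : SimpleGraph V) (hG : IsHLNetwork n G)
    (F : Finset (Sym2 V)) (hF : IsComponentEdgeCut G (g + 1) F)
    (hmin : F.card = componentEdgeConnectivity G (g + 1)) :
    {v : V | (G.deleteEdges (F : Set (Sym2 V))).IsIsolated v}.encard = g := by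
  classical
  have := hG.finite_and_natCard.1
  have := Fintype.ofFinite V
  have hcard : Fintype.card V = 2 ^ n := by
    rw [← Nat.card_eq_fintype_card, hG.finite_and_natCard.2]
  obtain ⟨t, rfl⟩ : ∃ t, n = t + 2 := ⟨n - 2, by omega⟩
  have hgt : g ≤ 2 ^ t := by
    refine hg.trans (Nat.pow_le_pow_right (by norm_num) (Nat.ceil_le.2 ?_))
    have : (6 : ℚ) ≤ t := by exact_mod_cast (show 6 ≤ t by omega)
    push_cast
    linarith
  have ht : 2 ≤ 2 ^ t := by
    calc 2 = 2 ^ 1 := rfl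
      _ ≤ 2 ^ t := Nat.pow_le_pow_right (by norm_num) (by omega)
  have hn4 : 2 ^ (t + 2) = 4 * 2 ^ t := by ring
  have hlow := hG.bitSum_le_spannedPairs_deleteEdges (by omega) hF hmin
  set H := G.deleteEdges (F : Set (Sym2 V)) with hH
  have hHG : H ≤ G := SimpleGraph.deleteEdges_le _
  have : Fintype H.ConnectedComponent := Fintype.ofFinite _
  have hcomp : g + 1 ≤ Fintype.card H.ConnectedComponent := by
    have := hF.2
    rwa [ENat.card_eq_coe_fintype_card, Nat.cast_le] at this
  set x : H.ConnectedComponent → ℕ := fun c => c.supp.ncard - 1 with hx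
  have hx1 : ∀ c, c.supp.ncard = x c + 1 := fun c =>
    (Nat.succ_pred_eq_of_pos ((Set.ncard_pos (Set.toFinite _)).2 c.nonempty_supp)).symm
  have hfib : ∀ c : H.ConnectedComponent,
      (Finset.univ.filter fun v => H.connectedComponentMk v = c).card = x c + 1 := by
    intro c
    rw [← hx1, ← Set.ncard_coe_finset]
    congr 1
    ext v
    simp
  have hsum : ∑ c, x c + Fintype.card H.ConnectedComponent = 2 ^ (t + 2) := by
    rw [← hcard, ← Finset.card_univ (α := V), Finset.card_eq_sum_card_fiberwise
      (f := H.connectedComponentMk) (t := Finset.univ) (fun _ _ => Finset.mem_univ _)]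
    simp [hfib, Finset.sum_add_distrib]
  have hup : spannedPairs H Finset.univ ≤ 2 * ∑ c, bitSum (x c + 1) := by
    rw [spannedPairs_univ_eq_sum_components, Finset.mul_sum]
    refine Finset.sum_le_sum fun c _ => ?_
    rw [← hfib]
    exact (spannedPairs_mono_left hHG _).trans (hG.spannedPairs_le _)
  have hN : 2 ^ (t + 2) - g = 2 ^ (t + 2) - g - 1 + 1 := by omega
  -- Comparing with the lower bound forces exactly `g + 1` components.
  have hS : ∑ c, x c = 2 ^ (t + 2) - g - 1 := by
    refine le_antisymm (by omega) (bitSum_succ_strictMono.le_iff_le.1 ?_)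
    have := sum_bitSum_succ_le Finset.univ x
    rw [hN] at hlow
    omega
  -- The sum lies strictly between `2 ^ (t + 1)` and `2 ^ (t + 2)`.
  have hpow : ∀ k, ∑ c, x c ≠ 2 ^ k := by
    intro k hk
    have h1 : 2 ^ (t + 1) < 2 ^ k := by rw [← hk, hS, pow_succ]; omega
    have h2 : 2 ^ k < 2 ^ (t + 2) := by omega
    have h1' := (Nat.pow_lt_pow_iff_right (by norm_num)).1 h1
    have h2' := (Nat.pow_lt_pow_iff_right (by norm_num)).1 h2
    omega
  obtain ⟨c, -, hc⟩ : ∃ c ∈ Finset.univ, x c ≠ 0 :=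
    Finset.exists_ne_zero_of_sum_ne_zero (by omega)
  have hne : ∀ d, d ≠ c → x d = 0 := by
    intro d hd
    by_contra hd0
    have := sum_bitSum_succ_lt (Finset.mem_univ d) (Finset.mem_univ c) hd
      (Nat.pos_of_ne_zero hd0) (Nat.pos_of_ne_zero hc) hpow
    rw [hS, ← hN] at this
    omega
  have hxc : x c = 2 ^ (t + 2) - g - 1 := by
    rw [← hS, Finset.sum_eq_single c (fun d _ hd => hne d hd) (by simp)]
  have hset : {v : V | H.IsIsolated v} = c.suppᶜ := by
    ext v
    exact isIsolated_iff_of_forall_component (by rw [hx1]; omega)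
      (fun d hd => by rw [hx1, hne d hd]) v
  rw [hset, ← Set.Finite.cast_ncard_eq (Set.toFinite _), Set.ncard_compl,
    Nat.card_eq_fintype_card, hcard, hx1, hxc]
  congr 1
  omega
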